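/- Theorem (Solution to the maximization problem). A (bivariate) copula is a function $C\colon[0,1]^2\to[0,1]$ with $C(u,0)=0=C(0,u)$ and $C(u,1)=u=C(1,u)$ for all $u$, and $C(u,v)+C(u',v')-C(u,v')-C(u',v)\ge 0$ whenever $u\le u'$, $v\le v'$. For a copula $C$ put $$\rho(C)=12\int_{[0,1]^2}C\,d\lambda^2-3,\qquad \xi(C)=6\int_0^1\!\int_0^1(\partial_1C(t,v))^2\,dt\,dv-2 .$$ For $c\in[0,1]$ consider the problem $$(\ast)_c\qquad \text{maximize } \rho(C)\ \text{ over all copulas } C \text{ with } \xi(C)=c .$$ For $b>0$ and $v\in[0,1]$ let $$s_v=\begin{cases}\sqrt{2v/b}, & (b\ge1,\ v\le\frac1{2b})\text{ or }(b\le1,\ v\le\frac b2),\\ v+\frac1{2b}, & \frac1{2b}<v\le1-\frac1{2b},\\ \frac vb+\frac12, & \frac b2<v\le1-\frac b2,\\ 1+\frac1b-\sqrt{2(1-v)/b}, & (b\ge1,\ v>1-\frac1{2b})\text{ or }(b\le1,\ v>1-\frac b2),\end{cases}$$ let $a_v=\max\{s_v-\frac1b,0\}$, and for $u,v\in[0,1]$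 $$C_b(u,v)=\begin{cases}u, & 0\le u\le a_v,\\ a_v+b\bigl(s_v(u-a_v)+\tfrac{a_v^2-u^2}{2}\bigr), & a_v<u\le s_v,\\ v, & s_v<u\le1.\end{cases}$$ For $x\in(0,1)$ let $$b_x=\begin{cases}\dfrac{\sqrt{6x}}{2\cos\left(\frac13\arccos\left(-\frac{3\sqrt{6x}}5\right)\right)}, & 0<x\le\frac3{10},\\[2ex] \dfrac{5+\sqrt{5(6x-1)}}{10(1-x)}, & \frac3{10}<x<1,\end{cases}\qquad M_x=\begin{cases} b_x-\frac{3b_x^2}{10}, & 0<x\le\frac3{10},\\ 1-\frac1{2b_x^2}+\frac1{5b_x^3}, & \frac3{10}<x<1,\end{cases}$$ and $M_0=0$, $M_1=1$. Write $\Pi(u,v)=uv$ and $M(u,v)=\min\{u,v\}$. For every $b>0$, the function $C_b$ is a copula; it is stochastically increasing (for $(U_1,U_2)\sim C_b$ and every $v$, $u\mapsto P(U_2\ge v\mid U_1=u)$ is increasing outside a Lebesgue null set), and for all $t,v\in[0,1]$, $\partial_1C_b(t,v)=\min\{\max\{b(s_v-t),0\},1\}$ (one-sided derivatives at $t=0,1$).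 Moreover: (i) If $c\in(0,1)$, then $b_c>0$ and $C_{b_c}$ is the unique solution of $(\ast)_c$; in particular $\xi(C_{b_c})=c$, and $\rho(C_{b_c})=M_c$. (ii) $\Pi$ is the unique solution of $(\ast)_0$, $\rho(\Pi)=M_0$, and $C_b\to\Pi$ uniformly on $[0,1]^2$ as $b\downarrow0$. (iii) $M$ is the unique solution of $(\ast)_1$, $\rho(M)=M_1$, and $C_b\to M$ uniformly on $[0,1]^2$ as $b\to\infty$. -/

import Mathlib

open MeasureTheory Filter Topology Set unitInterval

noncomputable section

namespace XiRho

/-- A bivariate copula on the closed unit square: a function with values in `[0,1]` that is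
grounded, has uniform marginals and is two-increasing. -/
structure IsCopula (C : I × I → ℝ) : Prop where
  mem_Icc : ∀ p, C p ∈ Icc (0 : ℝ) 1
  grounded_left : ∀ v, C (0, v) = 0
  grounded_right : ∀ u, C (u, 0) = 0
  marginal_left : ∀ u, C (u, 1) = u
  marginal_right : ∀ v, C (1, v) = v
  two_increasing : ∀ u u' v v', u ≤ u' → v ≤ v' →
    0 ≤ C (u, v) + C (u', v') - C (u, v') - C (u', v)

/-- The section `u ↦ C (u, v)`, extended constantly from `[0,1]` to `ℝ`, so that it can be
differentiated within `[0,1]`. -/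
def firstSection (C : I × I → ℝ) (v : I) : ℝ → ℝ :=
  IccExtend zero_le_one fun u : I => C (u, v)

/-- The partial derivative `∂₁C(t, v)` in the first argument (one-sided for `t = 0` and `t = 1`).
For a copula and fixed `v` it exists for Lebesgue almost all `t`. -/
def partialOne (C : I × I → ℝ) (t v : I) : ℝ :=
  derivWithin (firstSection C v) (Icc 0 1) t

/-- Spearman's rho, `ρ(C) = 12 ∫_{[0,1]²} C dλ² - 3`. -/
def spearmanRho (C : I × I → ℝ) : ℝ := 12 * (∫ p : I × I, C p) - 3

/-- Chatterjee's xi, `ξ(C) = 6 ∫₀¹ ∫₀¹ (∂₁C(t, v))² dt dv - 2`. -/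
def chatterjeeXi (C : I × I → ℝ) : ℝ := 6 * (∫ v : I, ∫ t : I, partialOne C t v ^ 2) - 2

/-- `C` is the copula of a random vector `(U₁, U₂)` with joint law `μ` on the unit square:
`P(U₁ ≤ u, U₂ ≤ v) = C(u, v)`. -/
def HasLaw (C : I × I → ℝ) (μ : Measure (I × I)) : Prop :=
  ∀ u v : I, μ.real (Iic u ×ˢ Iic v) = C (u, v)

/-- A copula `C` is stochastically increasing (SI) if for `(U₁, U₂) ∼ C` and every `v`, the
conditional probability `P(U₂ ≥ v ∣ U₁ = u)` is increasing in `u` outside a Lebesgue null set.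
(The law of `(U₁, U₂)` is determined by `C`.) -/
def IsSI (C : I × I → ℝ) : Prop :=
  IsCopula C ∧ ∃ (μ : Measure (I × I)) (_ : IsProbabilityMeasure μ), HasLaw C μ ∧
    ∀ v : I, ∃ N : Set I, volume N = 0 ∧
      MonotoneOn (fun u : I => (μ.condKernel u).real (Ici v)) Nᶜ

/-- `C` solves `max {ρ(D) : D copula, ξ(D) = c}`. -/
def IsMaximizer (c : ℝ) (C : I × I → ℝ) : Prop :=
  IsCopula C ∧ chatterjeeXi C = c ∧
    ∀ D, IsCopula D → chatterjeeXi D = c → spearmanRho D ≤ spearmanRho C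

/-- `C` is the unique solution of `max {ρ(D) : D copula, ξ(D) = c}`. -/
def IsUniqueMaximizer (c : ℝ) (C : I × I → ℝ) : Prop :=
  IsMaximizer c C ∧ ∀ D, IsMaximizer c D → D = C

/-- The independence copula `Π(u, v) = u v`. -/
def copPi (p : I × I) : ℝ := (p.1 : ℝ) * p.2

/-- The upper Fréchet copula `M(u, v) = min {u, v}`. -/
def copM (p : I × I) : ℝ := min (p.1 : ℝ) p.2

/-- The upper end `s_v` of the linear part of the clamped function `t ↦ b (s_v - t)`. -/
def sPar (b v : ℝ) : ℝ :=
  if (1 ≤ b ∧ v ≤ 1 / (2 * b)) ∨ (b ≤ 1 ∧ v ≤ b / 2) then √(2 * v / b)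
  else if 1 / (2 * b) < v ∧ v ≤ 1 - 1 / (2 * b) then v + 1 / (2 * b)
  else if b / 2 < v ∧ v ≤ 1 - b / 2 then v / b + 1 / 2
  else 1 + 1 / b - √(2 * (1 - v) / b)

/-- The lower end of the linear part within `[0,1]`, namely `max {s_v - 1/b, 0}`. -/
def aPar (b v : ℝ) : ℝ := max (sPar b v - 1 / b) 0

/-- The function `C_b` on the unit square (for `b > 0`). -/
def copC (b : ℝ) (p : I × I) : ℝ :=
  let u : ℝ := p.1
  let v : ℝ := p.2
  let s := sPar b v
  let a := aPar b v
  if u ≤ a then u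
  else if u ≤ s then a + b * (s * (u - a) + (a ^ 2 - u ^ 2) / 2)
  else v

/-- The clipped ramp `clamp(y, α, β) = min {max {y, α}, β}`. -/
def clamp (y α β : ℝ) : ℝ := min (max y α) β

/-- The parameter `b_x`, for `0 < x < 1`. -/
def bPar (x : ℝ) : ℝ :=
  if x ≤ 3 / 10 then
    √(6 * x) / (2 * Real.cos (1 / 3 * Real.arccos (-(3 * √(6 * x) / 5))))
  else (5 + √(5 * (6 * x - 1))) / (10 * (1 - x))

/-- The value `M_x`, for `0 ≤ x ≤ 1`. -/
def maxRho (x : ℝ) : ℝ :=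
  if x = 0 then 0
  else if x ≤ 3 / 10 then bPar x - 3 * bPar x ^ 2 / 10
  else if x < 1 then 1 - 1 / (2 * bPar x ^ 2) + 1 / (5 * bPar x ^ 3)
  else 1

end XiRho

end

/-!
For a copula `C` whose partial derivative has the form `∂₁C(t, v) = clamp(g(v) - b t, 0, 1)`, the
value `∂₁C(t, v)` is the projection of `g(v) - b t` to `[0,1]`. Since every copula `D` satisfies
`∂₁D ∈ [0,1]` and `∫ ∂₁D(t, v) dt = v`, this makes `C` the unique maximizer of the Lagrangian
`b ρ - ξ`, hence of `ρ` among the copulas with the same `ξ`. The copula `C_b` is the case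
`g(v) = b s_v`, where the marginal condition forces `v ↦ s_v` to be the quantile function of
`U + W / b` for independent uniformly distributed `U` and `W`.

If `F_b` is the distribution function of `U + W / b`, then `T = F_b(U + W / b)` satisfies
`(U, T) ∼ C_b`, with `w ↦ F_b(t + w / b)` the conditional quantile function given `U = t`. Hence
`C_b` is stochastically increasing, `ρ(C_b) = 12 E[U T] - 3` and `ξ(C_b) = 4 - 12 E[W T]`. As
`U` and `W` play symmetric roles, `ξ(C_b) = 1 - ρ(C_{1/b})`, so that a single integral gives both
coefficients; solving `ξ(C_b) = c` for `b` amounts to a quadratic equation for `b ≥ 1` and to a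
cubic one, solved trigonometrically, for `b ≤ 1`.
-/

noncomputable section

namespace XiRho

/-! ### Integrals over the unit interval -/

lemma integral_coe_unitInterval (f : ℝ → ℝ) : ∫ t : I, f t = ∫ t in (0 : ℝ)..1, f t := by
  rw [intervalIntegral.integral_of_le zero_le_one, ← integral_Icc_eq_integral_Ioc]
  exact unitInterval.measurePreserving_coe.integral_comp unitInterval.measurableEmbedding_coe f

lemma setIntegral_Iic_unitInterval (u : I) (f : ℝ → ℝ) :
    ∫ t in Iic u, f (t : I) = ∫ t in (0 : ℝ)..u, f t := by
  have h := unitInterval.measurePreserving_coe.setIntegral_image_emb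
    unitInterval.measurableEmbedding_coe f (Iic u)
  rw [image_subtype_val_Icc_Iic, Measure.restrict_restrict measurableSet_Icc,
    inter_eq_left.2 (Icc_subset_Icc_right u.2.2)] at h
  rw [← h, intervalIntegral.integral_of_le u.2.1, integral_Icc_eq_integral_Ioc]

lemma integrable_of_continuous {X : Type*} [TopologicalSpace X] [CompactSpace X]
    [MeasurableSpace X] [OpensMeasurableSpace X] {μ : Measure X} [IsFiniteMeasureOnCompacts μ]
    {f : X → ℝ} (hf : Continuous f) : Integrable f μ :=
  hf.integrable_of_hasCompactSupport (HasCompactSupport.of_compactSpace f)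

lemma ae_fst_ne (x : I) : ∀ᵐ p : I × I, p.1 ≠ x :=
  Measure.quasiMeasurePreserving_fst.ae (Measure.ae_ne volume x)

lemma ae_snd_ne (x : I) : ∀ᵐ p : I × I, p.2 ≠ x :=
  Measure.quasiMeasurePreserving_snd.ae (Measure.ae_ne volume x)

instance isOpenPosMeasure_unitInterval : (volume : Measure I).IsOpenPosMeasure where
  open_pos U hU hne := by
    obtain ⟨V, hV, rfl⟩ := isOpen_induced_iff.1 hU
    obtain ⟨x, hx⟩ := hne
    have hx_closure : (x : ℝ) ∈ closure (Ioo (0 : ℝ) 1) := by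
      rw [closure_Ioo zero_ne_one]
      exact x.2
    have hpos : 0 < volume (V ∩ Ioo 0 1) :=
      (hV.inter isOpen_Ioo).measure_pos volume (mem_closure_iff.1 hx_closure V hV hx)
    rw [unitInterval.volume_apply, Subtype.image_preimage_coe]
    have hsub : V ∩ Ioo 0 1 ⊆ Icc 0 1 ∩ V := fun y hy => ⟨Ioo_subset_Icc_self hy.2, hy.1⟩
    exact (hpos.trans_le (measure_mono hsub)).ne'

lemma integral_setIntegral_le {α : Type*} [MeasurableSpace α] {μ : Measure α} [SFinite μ]
    {τ : α → I} (hτ : Measurable τ) {g : α → ℝ} (hg : Integrable g μ) :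
    ∫ v : I, ∫ a in {a | τ a ≤ v}, g a ∂μ = ∫ a, (1 - (τ a : ℝ)) * g a ∂μ := by
  have hle : MeasurableSet {q : I × α | τ q.2 ≤ q.1} :=
    measurableSet_le (hτ.comp measurable_snd) measurable_fst
  have hint : Integrable ({q : I × α | τ q.2 ≤ q.1}.indicator fun q => g q.2)
      ((volume : Measure I).prod μ) := (hg.comp_snd _).indicator hle
  calc ∫ v : I, ∫ a in {a | τ a ≤ v}, g a ∂μ
      = ∫ v : I, ∫ a, {q : I × α | τ q.2 ≤ q.1}.indicator (fun q => g q.2) (v, a) ∂μ :=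
        integral_congr_ae <| ae_of_all _ fun v =>
          (integral_indicator (measurableSet_le hτ measurable_const)).symm
    _ = ∫ a, (∫ v : I, (Ici (τ a)).indicator (fun _ => g a) v) ∂μ :=
        integral_integral_swap (f := fun v a => _) hint
    _ = ∫ a, (1 - (τ a : ℝ)) * g a ∂μ := by
        simp only [integral_indicator_const _ measurableSet_Ici, Measure.real,
          unitInterval.volume_Ici, smul_eq_mul,
          ENNReal.toReal_ofReal (sub_nonneg.2 (unitInterval.le_one _))]

/-! ### Regularity of copulas -/

lemma firstSection_coe (C : I × I → ℝ) (u v : I) : firstSection C v u = C (u, v) := by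
  simp only [firstSection, IccExtend_val]

lemma partialOne_eq_deriv (C : I × I → ℝ) {t : I} (h0 : t ≠ 0) (h1 : t ≠ 1) (v : I) :
    partialOne C t v = deriv (firstSection C v) t :=
  derivWithin_of_mem_nhds <| Icc_mem_nhds (unitInterval.pos_iff_ne_zero.2 h0)
    (unitInterval.lt_one_iff_ne_one.2 h1)

lemma partialOne_ae_eq_deriv (C : I × I → ℝ) (v : I) :
    ∀ᵐ t : I, partialOne C t v = deriv (firstSection C v) t := by
  filter_upwards [Measure.ae_ne volume (0 : I), Measure.ae_ne volume (1 : I)] with t h0 h1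
  exact partialOne_eq_deriv C h0 h1 v

namespace IsCopula

variable {C D : I × I → ℝ}

lemma swap (h : IsCopula C) : IsCopula (C ∘ Prod.swap) where
  mem_Icc p := h.mem_Icc p.swap
  grounded_left := h.grounded_right
  grounded_right := h.grounded_left
  marginal_left := h.marginal_right
  marginal_right := h.marginal_left
  two_increasing u u' v v' hu hv := by
    have := h.two_increasing v v' u u' hv hu
    simp only [Function.comp_apply, Prod.swap_prod_mk]
    linarith

lemma mono_left (h : IsCopula C) (v : I) : Monotone fun u => C (u, v) := fun u u' huu' => by
  have := h.two_increasing u u' 0 v huu' v.2.1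
  simp only [h.grounded_right] at this
  linarith

lemma sub_le_left (h : IsCopula C) {u u' : I} (v : I) (huu' : u ≤ u') :
    C (u', v) - C (u, v) ≤ u' - u := by
  have := h.two_increasing u u' v 1 huu' v.2.2
  simp only [h.marginal_left] at this
  linarith

lemma lipschitzWith_left (h : IsCopula C) (v : I) : LipschitzWith 1 fun u => C (u, v) := by
  refine LipschitzWith.of_le_add fun u u' => ?_
  rw [Subtype.dist_eq, Real.dist_eq]
  rcases le_total u u' with huu' | huu'
  · exact (h.mono_left v huu').trans (le_add_of_nonneg_right (abs_nonneg _))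
  · linarith [h.sub_le_left v huu', le_abs_self ((u : ℝ) - u')]

lemma lipschitzWith_right (h : IsCopula C) (u : I) : LipschitzWith 1 fun v => C (u, v) :=
  h.swap.lipschitzWith_left u

lemma continuous (h : IsCopula C) : Continuous C :=
  (LipschitzWith.uncurry (f := fun u v => C (u, v)) h.lipschitzWith_left
    h.lipschitzWith_right).continuous

lemma integrable (h : IsCopula C) : Integrable C := integrable_of_continuous h.continuous

lemma le_copM (h : IsCopula C) (p : I × I) : C p ≤ copM p :=
  le_min ((h.swap.mono_left p.1 p.2.2.2).trans_eq (h.marginal_left p.1))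
    ((h.mono_left p.2 p.1.2.2).trans_eq (h.marginal_right p.2))

lemma monotone_firstSection (h : IsCopula C) (v : I) : Monotone (firstSection C v) :=
  (h.mono_left v).IccExtend _

lemma lipschitzWith_firstSection (h : IsCopula C) (v : I) : LipschitzWith 1 (firstSection C v) := by
  simpa only [one_mul] using!
    (h.lipschitzWith_left v).comp (LipschitzWith.projIcc (zero_le_one (α := ℝ)))

lemma partialOne_nonneg (h : IsCopula C) (t v : I) : 0 ≤ partialOne C t v :=
  ((h.monotone_firstSection v).monotoneOn _).derivWithin_nonneg

lemma partialOne_le_one (h : IsCopula C) (t v : I) : partialOne C t v ≤ 1 := by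
  have hmono : Monotone fun x => x - firstSection C v x := fun x y hxy => by
    have hdist := (le_abs_self _).trans ((h.lipschitzWith_firstSection v).dist_le_mul y x)
    rw [NNReal.coe_one, one_mul, Real.dist_eq, abs_of_nonneg (sub_nonneg.2 hxy)] at hdist
    linarith
  by_cases hdiff : DifferentiableWithinAt ℝ (firstSection C v) (Icc 0 1) t
  · have hderiv := (hmono.monotoneOn (Icc 0 1)).derivWithin_nonneg (x := (t : ℝ))
    have hunique := uniqueDiffOn_Icc zero_lt_one (t : ℝ) t.2
    rw [derivWithin_fun_sub differentiableWithinAt_fun_id hdiff,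
      derivWithin_id' _ _ hunique] at hderiv
    exact sub_nonneg.1 hderiv
  · rw [partialOne, derivWithin_zero_of_not_differentiableWithinAt hdiff]
    exact zero_le_one

lemma abs_partialOne_le_one (h : IsCopula C) (t v : I) : |partialOne C t v| ≤ 1 :=
  abs_le.2 ⟨by linarith [h.partialOne_nonneg t v], h.partialOne_le_one t v⟩

lemma continuous_uncurry_firstSection (h : IsCopula C) :
    Continuous (Function.uncurry fun v : I => firstSection C v) :=
  h.continuous.comp ((continuous_projIcc.comp continuous_snd).prodMk continuous_fst)

lemma aestronglyMeasurable_partialOne (h : IsCopula C) :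
    AEStronglyMeasurable (fun p : I × I => partialOne C p.1 p.2) := by
  have hderiv : Measurable fun p : I × I => deriv (firstSection C p.2) p.1 :=
    (measurable_deriv_with_param h.continuous_uncurry_firstSection).comp
      (measurable_snd.prodMk (measurable_subtype_coe.comp measurable_fst))
  refine hderiv.aestronglyMeasurable.congr ?_
  filter_upwards [ae_fst_ne 0, ae_fst_ne 1] with p h0 h1
  exact (partialOne_eq_deriv C h0 h1 p.2).symm

lemma integrable_mul_partialOne (h : IsCopula C) {g : I × I → ℝ} (hg : Integrable g) :
    Integrable fun p : I × I => g p * partialOne C p.1 p.2 :=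
  hg.mul_bdd (c := 1) h.aestronglyMeasurable_partialOne <| ae_of_all _ fun p =>
    h.abs_partialOne_le_one p.1 p.2

lemma integrable_partialOne (h : IsCopula C) :
    Integrable fun p : I × I => partialOne C p.1 p.2 := by
  simpa only [one_mul] using h.integrable_mul_partialOne (integrable_const 1)

lemma integrable_partialOne_sq (h : IsCopula C) :
    Integrable fun p : I × I => partialOne C p.1 p.2 ^ 2 := by
  simpa only [sq] using h.integrable_mul_partialOne h.integrable_partialOne

lemma setIntegral_partialOne (h : IsCopula C) (u v : I) :
    ∫ t in Iic u, partialOne C t v = C (u, v) := by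
  have h0 : firstSection C v 0 = 0 := by
    have := firstSection_coe C 0 v
    rwa [Icc.coe_zero, h.grounded_left] at this
  rw [setIntegral_congr_ae measurableSet_Iic ((partialOne_ae_eq_deriv C v).mono fun t ht _ => ht),
    setIntegral_Iic_unitInterval u (deriv (firstSection C v)),
    (h.lipschitzWith_firstSection v).lipschitzOnWith.absolutelyContinuousOnInterval
      |>.integral_deriv_eq_sub, firstSection_coe]
  rw [h0, sub_zero]

lemma integral_partialOne (h : IsCopula C) (v : I) : ∫ t : I, partialOne C t v = v := by
  have huniv : Iic (1 : I) = univ := Iic_top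
  rw [← h.marginal_right, ← h.setIntegral_partialOne, huniv, setIntegral_univ]

lemma integrable_partialOne_section (h : IsCopula C) (v : I) :
    Integrable fun t : I => partialOne C t v := by
  have hderiv : Measurable fun t : I => deriv (firstSection C v) t :=
    (measurable_deriv _).comp measurable_subtype_coe
  exact Integrable.of_bound (hderiv.aestronglyMeasurable.congr
    ((partialOne_ae_eq_deriv C v).mono fun _ => Eq.symm)) 1 <|
    ae_of_all _ fun t => h.abs_partialOne_le_one t v

lemma integral_section (h : IsCopula C) (v : I) :
    ∫ u : I, C (u, v) = ∫ t : I, (1 - (t : ℝ)) * partialOne C t v := by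
  simp only [← h.setIntegral_partialOne _ v]
  exact integral_setIntegral_le measurable_id (h.integrable_partialOne_section v)

lemma integrable_one_sub_mul_partialOne (h : IsCopula C) :
    Integrable fun p : I × I => (1 - (p.1 : ℝ)) * partialOne C p.1 p.2 :=
  h.integrable_mul_partialOne (integrable_of_continuous (by fun_prop))

lemma spearmanRho_eq (h : IsCopula C) :
    spearmanRho C = 12 * (∫ p : I × I, (1 - (p.1 : ℝ)) * partialOne C p.1 p.2) - 3 := by
  have hC := h.integrable
  have hg := h.integrable_one_sub_mul_partialOne
  rw [Measure.volume_eq_prod] at hC hg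
  rw [spearmanRho, Measure.volume_eq_prod, integral_prod_symm _ hC, integral_prod_symm _ hg]
  simp only [h.integral_section]

lemma chatterjeeXi_eq (h : IsCopula C) :
    chatterjeeXi C = 6 * (∫ p : I × I, partialOne C p.1 p.2 ^ 2) - 2 := by
  have := h.integrable_partialOne_sq
  rw [Measure.volume_eq_prod] at this ⊢
  rw [chatterjeeXi, integral_prod_symm _ this]

lemma integral_mul_partialOne_snd (h : IsCopula C) {g : I → ℝ} (hg : Integrable g) :
    ∫ p : I × I, g p.2 * partialOne C p.1 p.2 = ∫ v : I, g v * v := by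
  have := h.integrable_mul_partialOne (hg.comp_snd volume)
  rw [Measure.volume_eq_prod] at this ⊢
  rw [integral_prod_symm _ this]
  simp only [integral_const_mul, h.integral_partialOne]

lemma eq_of_partialOne_ae_eq (hC : IsCopula C) (hD : IsCopula D)
    (h : ∀ᵐ p : I × I, partialOne D p.1 p.2 = partialOne C p.1 p.2) : D = C := by
  have hsections : ∀ᵐ v : I, ∀ᵐ t : I, partialOne D t v = partialOne C t v :=
    Measure.ae_ae_of_ae_prod (Measure.measurePreserving_swap.quasiMeasurePreserving.ae h)
  funext ⟨u, v⟩
  suffices (fun v => D (u, v)) = fun v => C (u, v) from congrFun this v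
  refine ((hD.lipschitzWith_right u).continuous.ae_eq_iff_eq volume
    (hC.lipschitzWith_right u).continuous).1 ?_
  filter_upwards [hsections] with v hv
  rw [← hD.setIntegral_partialOne, ← hC.setIntegral_partialOne]
  exact setIntegral_congr_ae measurableSet_Iic (hv.mono fun t ht _ => ht)

end IsCopula

/-! ### Optimality of copulas with a clamped partial derivative -/

lemma clamp_mem_Icc (y : ℝ) : clamp y 0 1 ∈ Icc (0 : ℝ) 1 :=
  ⟨le_min (le_max_right _ _) zero_le_one, min_le_right _ _⟩

lemma clamp_of_nonpos {y : ℝ} (hy : y ≤ 0) : clamp y 0 1 = 0 := by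
  rw [clamp, max_eq_right hy, min_eq_left zero_le_one]

lemma clamp_of_mem_Icc {y : ℝ} (hy : y ∈ Icc (0 : ℝ) 1) : clamp y 0 1 = y := by
  rw [clamp, max_eq_left hy.1, min_eq_left hy.2]

lemma clamp_of_one_le {y : ℝ} (hy : 1 ≤ y) : clamp y 0 1 = 1 := by
  rw [clamp, max_eq_left (zero_le_one.trans hy), min_eq_right hy]

lemma sub_clamp_mul_nonpos (y : ℝ) {d : ℝ} (hd : d ∈ Icc (0 : ℝ) 1) :
    (d - clamp y 0 1) * (y - clamp y 0 1) ≤ 0 := by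
  rcases le_total y 0 with h0 | h0
  · rw [clamp_of_nonpos h0]
    nlinarith [hd.1]
  · rcases le_total y 1 with h1 | h1
    · rw [clamp_of_mem_Icc ⟨h0, h1⟩, sub_self, mul_zero]
    · rw [clamp_of_one_le h1]
      nlinarith [hd.2]

/-- The density of the Lagrangian of the maximization problem: up to a term that is the same for
all copulas, its integral is `(ξ(C) - b ρ(C)) / 6`, where `b` is the multiplier of the constraint
on `ξ` and `g` that of the constraint `∫ ∂₁C(t, v) dt = v`. -/
def lagrangianDensity (b : ℝ) (g : I → ℝ) (C : I × I → ℝ) (p : I × I) : ℝ :=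
  partialOne C p.1 p.2 ^ 2 - 2 * ((g p.2 - b * p.1) * partialOne C p.1 p.2)

lemma lagrangianDensity_eq (b : ℝ) (g : I → ℝ) (C : I × I → ℝ) :
    lagrangianDensity b g C = fun p => partialOne C p.1 p.2 ^ 2
      - (2 * b * ((1 - (p.1 : ℝ)) * partialOne C p.1 p.2)
        + 2 * ((g p.2 - b) * partialOne C p.1 p.2)) := by
  funext p
  rw [lagrangianDensity]
  ring

namespace IsCopula

variable {C D : I × I → ℝ} {b : ℝ} {g : I → ℝ}

lemma integrable_sub_mul_partialOne (h : IsCopula C) (hg : Integrable g) (b : ℝ) :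
    Integrable fun p : I × I => (g p.2 - b) * partialOne C p.1 p.2 :=
  h.integrable_mul_partialOne ((hg.sub' (integrable_const b)).comp_snd volume)

lemma integrable_lagrangianDensity (h : IsCopula C) (hg : Integrable g) (b : ℝ) :
    Integrable (lagrangianDensity b g C) := by
  rw [lagrangianDensity_eq]
  exact h.integrable_partialOne_sq.sub' ((h.integrable_one_sub_mul_partialOne.const_mul _).fun_add
    ((h.integrable_sub_mul_partialOne hg b).const_mul _))

lemma integral_lagrangianDensity (h : IsCopula C) (hg : Integrable g) (b : ℝ) :
    ∫ p, lagrangianDensity b g C p =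
      (chatterjeeXi C - b * spearmanRho C) / 6 +
        ((2 - 3 * b) / 6 - 2 * ∫ v : I, (g v - b) * v) := by
  have hrho := h.integrable_one_sub_mul_partialOne.const_mul (2 * b)
  have hg_int := (h.integrable_sub_mul_partialOne hg b).const_mul 2
  rw [lagrangianDensity_eq, integral_sub h.integrable_partialOne_sq (hrho.fun_add hg_int),
    integral_add hrho hg_int, integral_const_mul, integral_const_mul,
    h.integral_mul_partialOne_snd (hg.sub' (integrable_const b)), h.chatterjeeXi_eq,
    h.spearmanRho_eq]
  ring

lemma integrable_partialOne_sub_sq (hC : IsCopula C) (hD : IsCopula D) :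
    Integrable fun p : I × I => (partialOne D p.1 p.2 - partialOne C p.1 p.2) ^ 2 := by
  refine ((hD.integrable_partialOne_sq.fun_add hC.integrable_partialOne_sq).sub'
    ((hC.integrable_mul_partialOne hD.integrable_partialOne).const_mul 2)).congr <|
      ae_of_all _ fun p => ?_
  ring

lemma sub_add_integral_sq_le (hC : IsCopula C) (hD : IsCopula D) (hg : Integrable g)
    (hpart : ∀ t v : I, partialOne C t v = clamp (g v - b * t) 0 1) :
    b * spearmanRho D - chatterjeeXi D
        + 6 * ∫ p : I × I, (partialOne D p.1 p.2 - partialOne C p.1 p.2) ^ 2 ≤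
      b * spearmanRho C - chatterjeeXi C := by
  have hpointwise (p : I × I) : (partialOne D p.1 p.2 - partialOne C p.1 p.2) ^ 2 ≤
      lagrangianDensity b g D p - lagrangianDensity b g C p := by
    have := sub_clamp_mul_nonpos (g p.2 - b * p.1)
      ⟨hD.partialOne_nonneg p.1 p.2, hD.partialOne_le_one p.1 p.2⟩
    rw [← hpart] at this
    rw [lagrangianDensity, lagrangianDensity]
    linarith
  have hDint := hD.integrable_lagrangianDensity hg b
  have hCint := hC.integrable_lagrangianDensity hg b
  have hintegral := integral_mono (hC.integrable_partialOne_sub_sq hD) (hDint.sub' hCint) hpointwise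
  rw [integral_sub hDint hCint, hD.integral_lagrangianDensity hg,
    hC.integral_lagrangianDensity hg] at hintegral
  linarith

lemma eq_of_mul_spearmanRho_sub_le (hC : IsCopula C) (hD : IsCopula D) (hg : Integrable g)
    (hpart : ∀ t v : I, partialOne C t v = clamp (g v - b * t) 0 1)
    (hle : b * spearmanRho C - chatterjeeXi C ≤ b * spearmanRho D - chatterjeeXi D) : D = C := by
  have hnonpos : ∫ p : I × I, (partialOne D p.1 p.2 - partialOne C p.1 p.2) ^ 2 ≤ 0 := by
    linarith [hC.sub_add_integral_sq_le hD hg hpart]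
  have hzero := (integral_eq_zero_iff_of_nonneg (fun p => sq_nonneg _)
    (hC.integrable_partialOne_sub_sq hD)).1
    (hnonpos.antisymm (integral_nonneg fun p => sq_nonneg _))
  refine hC.eq_of_partialOne_ae_eq hD ?_
  filter_upwards [hzero] with p hp
  exact sub_eq_zero.1 (sq_eq_zero_iff.1 hp)

lemma isUniqueMaximizer_of_clamp (hC : IsCopula C) (hb : 0 ≤ b) (hg : Integrable g)
    (hpart : ∀ t v : I, partialOne C t v = clamp (g v - b * t) 0 1) :
    IsUniqueMaximizer (chatterjeeXi C) C := by
  have heq (D) (hD : IsCopula D) (hxi : chatterjeeXi D = chatterjeeXi C)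
      (hrho : spearmanRho C ≤ spearmanRho D) : D = C :=
    hC.eq_of_mul_spearmanRho_sub_le hD hg hpart (by rw [hxi]; gcongr)
  refine ⟨⟨hC, rfl, fun D hD hxi => ?_⟩, fun D ⟨hD, hxi, hmax⟩ => heq D hD hxi (hmax C hC rfl)⟩
  rcases le_total (spearmanRho D) (spearmanRho C) with hle | hge
  · exact hle
  · rw [heq D hD hxi hge]

end IsCopula

/-! ### Conditional quantile functions -/

open ProbabilityTheory in
lemma condKernel_map_prodMk_fst_ae_eq {α β Ω : Type*} [MeasurableSpace α] [MeasurableSpace β]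
    [MeasurableSpace Ω] [StandardBorelSpace Ω] [Nonempty Ω] (μ : Measure α) [IsFiniteMeasure μ]
    (ν : Measure β) [IsProbabilityMeasure ν] {T : α × β → Ω} (hT : Measurable T) :
    ∀ᵐ a ∂μ, ((μ.prod ν).map fun p => (p.1, T p)).condKernel a = ν.map fun b => T (a, b) := by
  let κ : Kernel α Ω := (Kernel.id ×ₖ Kernel.const α ν).map T
  have : IsMarkovKernel κ := Kernel.IsMarkovKernel.map _ hT
  have hκ (a : α) : κ a = ν.map fun b => T (a, b) := by
    rw [Kernel.map_apply _ hT, Kernel.prod_apply, Kernel.id_apply, Kernel.const_apply,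
      Measure.dirac_prod, Measure.map_map hT measurable_prodMk_left]
    rfl
  have hfst : (μ.prod ν).map Prod.fst = μ := Measure.fst_prod
  have hcompProd : (μ.prod ν).map (fun p => (p.1, T p)) = (μ.prod ν).map Prod.fst ⊗ₘ κ := by
    have hgraph : Measurable fun p : α × β => (p.1, T p) := measurable_fst.prodMk hT
    ext s hs
    rw [hfst, Measure.map_apply hgraph hs, Measure.prod_apply (hgraph hs),
      Measure.compProd_apply hs]
    refine lintegral_congr fun a => ?_
    rw [hκ]
    exact (Measure.map_apply (hT.comp measurable_prodMk_left) (measurable_prodMk_left hs)).symm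
  have hae := condDistrib_ae_eq_of_measure_eq_compProd Prod.fst hT.aemeasurable hcompProd
  rw [hfst, condDistrib] at hae
  filter_upwards [hae] with a ha
  rw [ha, hκ]

/-- `T` is a conditional quantile function of the copula `C`: if `U` and `W` are independent and
uniformly distributed on `[0,1]`, then `(U, T (U, W))` is distributed according to `C`. Since
`∂₁C(t, ·)` is the conditional distribution function given `U = t`, this is the Galois connection
between a distribution function and its quantile function. -/
structure IsCondQuantile (C : I × I → ℝ) (T : I × I → I) : Prop where
  measurable : Measurable T
  ae_le_iff : ∀ v, ∀ᵐ p : I × I, T p ≤ v ↔ (p.2 : ℝ) ≤ partialOne C p.1 v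

namespace IsCondQuantile

variable {C : I × I → ℝ} {T : I × I → I}

lemma setIntegral_le (hT : IsCondQuantile C T) (v : I) {g : I × I → ℝ} (hg : Integrable g) :
    ∫ p in {p | T p ≤ v}, g p = ∫ t : I, ∫ w in {w : I | (w : ℝ) ≤ partialOne C t v}, g (t, w) := by
  have hle : MeasurableSet {p | T p ≤ v} := measurableSet_le hT.measurable measurable_const
  have hint := hg.indicator hle
  have hsections : ∀ᵐ t : I, ∀ᵐ w : I, T (t, w) ≤ v ↔ (w : ℝ) ≤ partialOne C t v :=
    Measure.ae_ae_of_ae_prod (hT.ae_le_iff v)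
  rw [Measure.volume_eq_prod] at hint
  rw [← integral_indicator hle, Measure.volume_eq_prod, integral_prod _ hint]
  refine integral_congr_ae ?_
  filter_upwards [hsections] with t ht
  rw [← integral_indicator (measurableSet_le measurable_subtype_coe measurable_const)]
  refine integral_congr_ae ?_
  filter_upwards [ht] with w hw
  simp only [indicator, mem_ofPred_eq, hw]

lemma setIntegral_le_fst (hC : IsCopula C) (hT : IsCondQuantile C T) (v : I) {g : I → ℝ}
    (hg : Integrable g) :
    ∫ p in {p | T p ≤ v}, g p.1 = ∫ t : I, g t * partialOne C t v := by
  rw [hT.setIntegral_le v (hg.comp_fst volume)]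
  refine integral_congr_ae (ae_of_all _ fun t => ?_)
  let y : I := ⟨partialOne C t v, hC.partialOne_nonneg t v, hC.partialOne_le_one t v⟩
  have hvol : volume.real (Iic y) = partialOne C t v := by
    rw [Measure.real, unitInterval.volume_Iic, ENNReal.toReal_ofReal y.2.1]
  exact (setIntegral_const (g t)).trans (by rw [smul_eq_mul, mul_comm]; exact congrArg _ hvol)

lemma setIntegral_le_two_mul_snd (hC : IsCopula C) (hT : IsCondQuantile C T) (v : I) :
    ∫ p in {p | T p ≤ v}, 2 * (p.2 : ℝ) = ∫ t : I, partialOne C t v ^ 2 := by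
  rw [hT.setIntegral_le v (integrable_of_continuous (by fun_prop))]
  refine integral_congr_ae (ae_of_all _ fun t => ?_)
  let y : I := ⟨partialOne C t v, hC.partialOne_nonneg t v, hC.partialOne_le_one t v⟩
  have hIic := setIntegral_Iic_unitInterval y fun w => 2 * w
  rw [intervalIntegral.integral_const_mul, integral_id] at hIic
  refine hIic.trans ?_
  ring

lemma hasLaw (hC : IsCopula C) (hT : IsCondQuantile C T) :
    HasLaw C (volume.map fun p => (p.1, T p)) := fun u v => by
  have hgraph : Measurable fun p : I × I => (p.1, T p) := measurable_fst.prodMk hT.measurable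
  have hpre : (fun p : I × I => (p.1, T p)) ⁻¹' Iic u ×ˢ Iic v =
      (Prod.fst ⁻¹' Iic u) ∩ {p | T p ≤ v} := rfl
  have hu : MeasurableSet (Prod.fst ⁻¹' Iic u : Set (I × I)) := measurable_fst measurableSet_Iic
  have hfst := hT.setIntegral_le_fst hC v
    ((integrable_const (1 : ℝ)).indicator (measurableSet_Iic (a := u)))
  rw [map_measureReal_apply hgraph (measurableSet_Iic.prod measurableSet_Iic), hpre,
    ← measureReal_restrict_apply hu, ← integral_indicator_one hu, ← hC.setIntegral_partialOne,
    ← integral_indicator measurableSet_Iic]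
  refine hfst.trans (integral_congr_ae (ae_of_all _ fun t => ?_))
  simp only [indicator, ite_mul, one_mul, zero_mul]

lemma isSI (hC : IsCopula C) (hT : IsCondQuantile C T) (hmono : ∀ w, Monotone fun t => T (t, w)) :
    IsSI C := by
  have hgraph : Measurable fun p : I × I => (p.1, T p) := measurable_fst.prodMk hT.measurable
  refine ⟨hC, volume.map fun p => (p.1, T p),
    Measure.isProbabilityMeasure_map hgraph.aemeasurable, hT.hasLaw hC, fun v => ?_⟩
  have hae : ∀ᵐ t : I, ((volume : Measure (I × I)).map fun p => (p.1, T p)).condKernel t =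
      volume.map fun w => T (t, w) :=
    condKernel_map_prodMk_fst_ae_eq volume volume hT.measurable
  refine ⟨_, hae, fun t ht t' ht' htt' => ?_⟩
  rw [mem_compl_iff, notMem_compl_iff, mem_ofPred_eq] at ht ht'
  have hreal (t : I) : (volume.map fun w => T (t, w)).real (Ici v) =
      volume.real {w | v ≤ T (t, w)} :=
    map_measureReal_apply (hT.measurable.comp measurable_prodMk_left) measurableSet_Ici
  simp only [ht, ht', hreal]
  exact measureReal_mono fun w hw => hw.trans (hmono w htt')

lemma integrable_mul_coe (hT : IsCondQuantile C T) {g : I × I → ℝ} (hg : Integrable g) :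
    Integrable fun p => g p * (T p : ℝ) :=
  hg.mul_bdd (c := 1) (measurable_subtype_coe.comp hT.measurable).aestronglyMeasurable <|
    ae_of_all _ fun p => abs_le.2 ⟨by linarith [(T p).2.1], (T p).2.2⟩

lemma integral_setIntegral_le (hT : IsCondQuantile C T) {g : I × I → ℝ} (hg : Integrable g) :
    ∫ v : I, ∫ p in {p | T p ≤ v}, g p = (∫ p, g p) - ∫ p, g p * (T p : ℝ) := by
  rw [XiRho.integral_setIntegral_le hT.measurable hg, ← integral_sub hg (hT.integrable_mul_coe hg)]
  congr with p
  ring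

lemma integral_coe (hC : IsCopula C) (hT : IsCondQuantile C T) : ∫ p, (T p : ℝ) = 1 / 2 := by
  have h := hT.integral_setIntegral_le (integrable_const 1)
  simp only [hT.setIntegral_le_fst hC _ (integrable_const (1 : ℝ)), one_mul,
    hC.integral_partialOne, integral_const, probReal_univ, smul_eq_mul,
    integral_coe_unitInterval fun v => v, integral_id] at h
  linarith

lemma spearmanRho_eq (hC : IsCopula C) (hT : IsCondQuantile C T) :
    spearmanRho C = 12 * (∫ p, (p.1 : ℝ) * T p) - 3 := by
  have hone_sub : Integrable fun t : I => 1 - (t : ℝ) := integrable_of_continuous (by fun_prop)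
  have hT_int : Integrable fun p => (T p : ℝ) := by
    simpa only [one_mul] using hT.integrable_mul_coe (integrable_const 1)
  have hfst_mul : Integrable fun p => (p.1 : ℝ) * T p :=
    hT.integrable_mul_coe (integrable_of_continuous (by fun_prop))
  have hC_int := hC.integrable
  rw [Measure.volume_eq_prod] at hC_int
  have hintegral : ∫ p : I × I, (1 - (p.1 : ℝ)) = 1 / 2 := by
    rw [Measure.volume_eq_prod, integral_fun_fst fun t : I => 1 - (t : ℝ),
      integral_coe_unitInterval fun t => 1 - t, intervalIntegral.integral_sub (by simp) (by simp),
      intervalIntegral.integral_const, integral_id]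
    norm_num
  calc spearmanRho C
      = 12 * (∫ v : I, ∫ u : I, C (u, v)) - 3 := by
        rw [spearmanRho, Measure.volume_eq_prod, integral_prod_symm _ hC_int]
    _ = 12 * (∫ v : I, ∫ p in {p | T p ≤ v}, (1 - (p.1 : ℝ))) - 3 := by
        simp only [hC.integral_section, hT.setIntegral_le_fst hC _ hone_sub]
    _ = 12 * ((∫ p : I × I, (1 - (p.1 : ℝ))) - ∫ p, (1 - (p.1 : ℝ)) * T p) - 3 := by
        rw [hT.integral_setIntegral_le (hone_sub.comp_fst volume)]
    _ = 12 * (∫ p, (p.1 : ℝ) * T p) - 3 := by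
        simp only [sub_mul, one_mul]
        rw [integral_sub hT_int hfst_mul, hT.integral_coe hC, hintegral]
        ring

lemma chatterjeeXi_eq (hC : IsCopula C) (hT : IsCondQuantile C T) :
    chatterjeeXi C = 4 - 12 * ∫ p, (p.2 : ℝ) * T p := by
  have htwo_mul : Integrable fun p : I × I => 2 * (p.2 : ℝ) :=
    integrable_of_continuous (by fun_prop)
  have hintegral : ∫ p : I × I, 2 * (p.2 : ℝ) = 1 := by
    rw [Measure.volume_eq_prod, integral_fun_snd fun w : I => 2 * (w : ℝ),
      integral_coe_unitInterval fun w => 2 * w, intervalIntegral.integral_const_mul, integral_id]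
    norm_num
  rw [chatterjeeXi]
  simp only [← hT.setIntegral_le_two_mul_snd hC]
  rw [hT.integral_setIntegral_le htwo_mul, hintegral]
  simp only [mul_assoc, integral_const_mul]
  ring

end IsCondQuantile

/-! ### The extremal cases `Π` and `M` -/

lemma hasDerivWithinAt_firstSection {C : I × I → ℝ} {v : I} {f : ℝ → ℝ}
    (hf : ∀ u : I, C (u, v) = f u) {t : I} {d : ℝ} (hd : HasDerivWithinAt f d (Icc 0 1) t) :
    HasDerivWithinAt (firstSection C v) d (Icc 0 1) t := by
  have hsection (u : I) : firstSection C v u = f u := (firstSection_coe C u v).trans (hf u)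
  exact hd.congr (fun x hx => hsection ⟨x, hx⟩) (hsection t)

lemma partialOne_eq_of_hasDerivWithinAt {C : I × I → ℝ} {t v : I} {d : ℝ}
    (hd : HasDerivWithinAt (firstSection C v) d (Icc 0 1) t) : partialOne C t v = d :=
  hd.derivWithin (uniqueDiffOn_Icc zero_lt_one _ t.2)

lemma integral_fst_mul_snd : ∫ p : I × I, (p.1 : ℝ) * p.2 = 1 / 4 := by
  rw [Measure.volume_eq_prod, integral_prod_mul (fun t : I => (t : ℝ)) fun w : I => (w : ℝ),
    integral_coe_unitInterval fun t => t, integral_id]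
  norm_num

lemma integral_coe_mul_coe : ∫ t : I, (t : ℝ) * t = 1 / 3 := by
  simp only [← sq]
  rw [integral_coe_unitInterval fun t => t ^ 2, integral_pow]
  norm_num

lemma isCopula_copPi : IsCopula copPi where
  mem_Icc p := unitInterval.mul_mem p.1.2 p.2.2
  grounded_left v := zero_mul _
  grounded_right u := mul_zero _
  marginal_left u := mul_one _
  marginal_right v := one_mul _
  two_increasing u u' v v' hu hv := by
    have : (0 : ℝ) ≤ (u' - u) * (v' - v) := mul_nonneg (sub_nonneg.2 hu) (sub_nonneg.2 hv)
    simp only [copPi]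
    linarith

lemma partialOne_copPi (t v : I) : partialOne copPi t v = v :=
  partialOne_eq_of_hasDerivWithinAt <| hasDerivWithinAt_firstSection (fun _ => rfl)
    (hasDerivAt_mul_const (v : ℝ)).hasDerivWithinAt

lemma isCondQuantile_copPi : IsCondQuantile copPi Prod.snd where
  measurable := measurable_snd
  ae_le_iff v := ae_of_all _ fun p => by rw [partialOne_copPi, Subtype.coe_le_coe]

lemma spearmanRho_copPi : spearmanRho copPi = 0 := by
  rw [isCondQuantile_copPi.spearmanRho_eq isCopula_copPi, integral_fst_mul_snd]
  norm_num

lemma chatterjeeXi_copPi : chatterjeeXi copPi = 0 := by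
  rw [isCondQuantile_copPi.chatterjeeXi_eq isCopula_copPi, Measure.volume_eq_prod,
    integral_fun_snd fun w : I => (w : ℝ) * w, integral_coe_mul_coe, probReal_univ]
  norm_num

lemma isUniqueMaximizer_copPi : IsUniqueMaximizer 0 copPi := by
  have hcoe : Integrable fun v : I => (v : ℝ) := integrable_of_continuous continuous_subtype_val
  refine chatterjeeXi_copPi ▸ isCopula_copPi.isUniqueMaximizer_of_clamp le_rfl hcoe fun t v => ?_
  rw [partialOne_copPi, zero_mul, sub_zero, clamp_of_mem_Icc v.2]

lemma isCopula_copM : IsCopula copM where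
  mem_Icc p := ⟨le_min p.1.2.1 p.2.2.1, (min_le_left _ _).trans p.1.2.2⟩
  grounded_left v := min_eq_left v.2.1
  grounded_right u := min_eq_right u.2.1
  marginal_left u := min_eq_left u.2.2
  marginal_right v := min_eq_right v.2.2
  two_increasing u u' v v' hu hv := by
    have hu : (u : ℝ) ≤ u' := hu
    have hv : (v : ℝ) ≤ v' := hv
    simp only [copM]
    grind

lemma partialOne_copM_of_lt {t v : I} (h : t < v) : partialOne copM t v = 1 := by
  refine partialOne_eq_of_hasDerivWithinAt <| hasDerivWithinAt_firstSection
    (f := fun u => min u v) (fun _ => rfl) (HasDerivAt.hasDerivWithinAt ?_)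
  refine (hasDerivAt_id (t : ℝ)).congr_of_eventuallyEq ?_
  filter_upwards [Iio_mem_nhds (Subtype.coe_lt_coe.2 h)] with x hx
  exact min_eq_left (le_of_lt hx)

lemma partialOne_copM_of_gt {t v : I} (h : v < t) : partialOne copM t v = 0 := by
  refine partialOne_eq_of_hasDerivWithinAt <| hasDerivWithinAt_firstSection
    (f := fun u => min u v) (fun _ => rfl) (HasDerivAt.hasDerivWithinAt ?_)
  refine (hasDerivAt_const (t : ℝ) (v : ℝ)).congr_of_eventuallyEq ?_
  filter_upwards [Ioi_mem_nhds (Subtype.coe_lt_coe.2 h)] with x hx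
  exact min_eq_right (le_of_lt hx)

lemma isCondQuantile_copM : IsCondQuantile copM Prod.fst where
  measurable := measurable_fst
  ae_le_iff v := by
    filter_upwards [ae_fst_ne v, ae_snd_ne 0] with p ht hw
    rcases lt_or_gt_of_ne ht with hlt | hgt
    · simp only [partialOne_copM_of_lt hlt, hlt.le, unitInterval.le_one p.2]
    · simp only [partialOne_copM_of_gt hgt, hgt.not_ge,
        (unitInterval.coe_pos.2 (unitInterval.pos_iff_ne_zero.2 hw)).not_ge]

lemma spearmanRho_copM : spearmanRho copM = 1 := by
  rw [isCondQuantile_copM.spearmanRho_eq isCopula_copM, Measure.volume_eq_prod,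
    integral_fun_fst fun t : I => (t : ℝ) * t, integral_coe_mul_coe, probReal_univ]
  norm_num

lemma chatterjeeXi_copM : chatterjeeXi copM = 1 := by
  simp only [isCondQuantile_copM.chatterjeeXi_eq isCopula_copM, mul_comm ((Prod.snd _ : I) : ℝ),
    integral_fst_mul_snd]
  norm_num

lemma IsCopula.spearmanRho_le_copM {D : I × I → ℝ} (hD : IsCopula D) :
    spearmanRho D ≤ spearmanRho copM := by
  have := integral_mono hD.integrable isCopula_copM.integrable hD.le_copM
  rw [spearmanRho, spearmanRho]
  linarith

lemma IsCopula.eq_copM_of_spearmanRho_le {D : I × I → ℝ} (hD : IsCopula D)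
    (h : spearmanRho copM ≤ spearmanRho D) : D = copM := by
  have hintegral : ∫ p, D p = ∫ p, copM p := by
    have := h.antisymm hD.spearmanRho_le_copM
    rw [spearmanRho, spearmanRho] at this
    linarith
  have hae := (integral_eq_iff_of_ae_le hD.integrable isCopula_copM.integrable
    (ae_of_all _ hD.le_copM)).1 hintegral
  rw [Measure.volume_eq_prod] at hae
  exact (hD.continuous.ae_eq_iff_eq _ isCopula_copM.continuous).1 hae

lemma isUniqueMaximizer_copM : IsUniqueMaximizer 1 copM :=
  ⟨⟨isCopula_copM, chatterjeeXi_copM, fun _ hD _ => hD.spearmanRho_le_copM⟩,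
    fun _ ⟨hD, _, hmax⟩ => hD.eq_copM_of_spearmanRho_le (hmax _ isCopula_copM chatterjeeXi_copM)⟩

/-! ### The clamped ramp -/

lemma monotone_clamp : Monotone fun y : ℝ => clamp y 0 1 := fun _ _ h =>
  min_le_min_right 1 (max_le_max_right 0 h)

lemma abs_clamp_sub_clamp_le (x y : ℝ) : |clamp y 0 1 - clamp x 0 1| ≤ |y - x| :=
  (abs_min_sub_min_le_max _ _ _ _).trans <| max_le (abs_max_sub_max_le_abs y x 0) (by simp)

lemma clamp_lt_clamp {x y : ℝ} (hxy : x < y) (hx : x < 1) (hy : 0 < y) :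
    clamp x 0 1 < clamp y 0 1 := by
  simp only [clamp]
  grind

lemma le_clamp_iff {w y : ℝ} (hw : w ∈ Ioc (0 : ℝ) 1) : w ≤ clamp y 0 1 ↔ w ≤ y := by
  rw [clamp, le_min_iff, le_max_iff, or_iff_left hw.1.not_ge, and_iff_left hw.2]

lemma hasDerivAt_posPart_pow (n : ℕ) (x : ℝ) :
    HasDerivAt (fun y : ℝ => max y 0 ^ (n + 2)) ((n + 2) * max x 0 ^ (n + 1)) x := by
  have hpow (y : ℝ) : HasDerivAt (fun z : ℝ => z ^ (n + 2)) ((n + 2) * y ^ (n + 1)) y := by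
    simpa using hasDerivAt_pow (n + 2) y
  have hpow_zero : max (0 : ℝ) 0 ^ (n + 1) = 0 := by simp
  rcases lt_trichotomy x 0 with hneg | rfl | hpos
  · rw [max_eq_right hneg.le, zero_pow n.succ_ne_zero, mul_zero]
    refine (hasDerivAt_const x (0 : ℝ)).congr_of_eventuallyEq ?_
    filter_upwards [Iio_mem_nhds hneg] with y hy
    rw [max_eq_right (le_of_lt hy), zero_pow (by omega)]
  · have hleft : HasDerivWithinAt (fun y : ℝ => max y 0 ^ (n + 2))
        ((n + 2) * max (0 : ℝ) 0 ^ (n + 1)) (Iic 0) 0 := by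
      rw [hpow_zero, mul_zero]
      refine (hasDerivWithinAt_const (0 : ℝ) (Iic 0) (0 : ℝ)).congr (fun y hy => ?_) (by simp)
      rw [max_eq_right hy, zero_pow (by omega)]
    have hright : HasDerivWithinAt (fun y : ℝ => max y 0 ^ (n + 2))
        ((n + 2) * max (0 : ℝ) 0 ^ (n + 1)) (Ici 0) 0 := by
      rw [max_self]
      refine (hpow 0).hasDerivWithinAt.congr (fun y hy => ?_) (by simp)
      rw [max_eq_left hy]
    have := hleft.union hright
    rwa [Iic_union_Ici, hasDerivWithinAt_univ] at this
  · rw [max_eq_left hpos.le]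
    refine (hpow x).congr_of_eventuallyEq ?_
    filter_upwards [Ioi_mem_nhds hpos] with y hy
    rw [max_eq_left (le_of_lt hy)]

lemma hasDerivAt_posPart_add_pow (n : ℕ) (c x : ℝ) :
    HasDerivAt (fun y : ℝ => max (y + c) 0 ^ (n + 2)) ((n + 2) * max (x + c) 0 ^ (n + 1)) x :=
  (hasDerivAt_posPart_pow n (x + c)).comp_add_const x c

/-- The primitive `x ↦ ∫ clamp(b y, 0, 1) dy`, over `y ≤ x`, of the clamped ramp of slope `b`. -/
def rampPrimitive (b x : ℝ) : ℝ := b / 2 * (max x 0 ^ 2 - max (x - 1 / b) 0 ^ 2)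

variable {b : ℝ}

lemma mul_posPart_sub_posPart (hb : 0 < b) (x : ℝ) :
    b * (max x 0 - max (x - 1 / b) 0) = clamp (b * x) 0 1 := by
  have hx : b * (x - 1 / b) = b * x - 1 := by field_simp
  rw [mul_sub, mul_max_of_nonneg _ _ hb.le, mul_max_of_nonneg _ _ hb.le, hx, mul_zero, clamp]
  grind

lemma hasDerivAt_rampPrimitive (hb : 0 < b) (x : ℝ) :
    HasDerivAt (rampPrimitive b) (clamp (b * x) 0 1) x := by
  refine (((hasDerivAt_posPart_pow 0 x).sub
    (hasDerivAt_posPart_add_pow 0 (-(1 / b)) x)).const_mul (b / 2)).congr_deriv ?_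
  simp only [← mul_posPart_sub_posPart hb, Nat.cast_zero, zero_add, pow_one, sub_eq_add_neg]
  ring

lemma rampPrimitive_of_nonpos (hb : 0 < b) {x : ℝ} (hx : x ≤ 0) : rampPrimitive b x = 0 := by
  have hr : 0 < 1 / b := one_div_pos.2 hb
  rw [rampPrimitive, max_eq_right hx, max_eq_right (by linarith), sub_self, mul_zero]

lemma rampPrimitive_of_mem_Icc {x : ℝ} (hx : x ∈ Icc 0 (1 / b)) :
    rampPrimitive b x = b / 2 * x ^ 2 := by
  rw [rampPrimitive, max_eq_left hx.1, max_eq_right (sub_nonpos.2 hx.2)]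
  ring

lemma rampPrimitive_of_one_div_le (hb : 0 < b) {x : ℝ} (hx : 1 / b ≤ x) :
    rampPrimitive b x = x - 1 / (2 * b) := by
  have hr : 0 < 1 / b := one_div_pos.2 hb
  rw [rampPrimitive, max_eq_left (by linarith), max_eq_left (by linarith)]
  field_simp
  ring

lemma rampPrimitive_mem_Icc (hb : 0 < b) (x : ℝ) :
    rampPrimitive b x ∈ Icc (max x 0 - 1 / (2 * b)) (max x 0) := by
  have hr : 0 < 1 / (2 * b) := by positivity
  rcases le_total x 0 with h0 | h0
  · rw [rampPrimitive_of_nonpos hb h0, max_eq_right h0]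
    exact ⟨by linarith, le_rfl⟩
  rw [max_eq_left h0]
  rcases le_total x (1 / b) with h1 | h1
  · have hsq : 0 ≤ b / 2 * (x - 1 / b) ^ 2 := by positivity
    have hexpand : b / 2 * (x - 1 / b) ^ 2 = b / 2 * x ^ 2 - x + 1 / (2 * b) := by
      field_simp
      ring
    have hle : b * x ≤ 1 := by rwa [le_div_iff₀ hb, mul_comm] at h1
    rw [rampPrimitive_of_mem_Icc ⟨h0, h1⟩]
    exact ⟨by linarith, by nlinarith⟩
  · rw [rampPrimitive_of_one_div_le hb h1]
    exact ⟨le_rfl, by linarith⟩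

lemma exists_rampPrimitive_sub_eq (hb : 0 < b) {x y : ℝ} (hxy : x ≤ y) :
    ∃ z ∈ Icc x y, rampPrimitive b y - rampPrimitive b x = (y - x) * clamp (b * z) 0 1 := by
  rcases hxy.eq_or_lt with rfl | hlt
  · exact ⟨x, left_mem_Icc.2 le_rfl, by rw [sub_self, sub_self, zero_mul]⟩
  · obtain ⟨z, hz, hslope⟩ := exists_hasDerivAt_eq_slope (rampPrimitive b)
      (fun z => clamp (b * z) 0 1) hlt
      (fun z _ => (hasDerivAt_rampPrimitive hb z).continuousAt.continuousWithinAt)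
      fun z _ => hasDerivAt_rampPrimitive hb z
    exact ⟨z, Ioo_subset_Icc_self hz, by rw [hslope, mul_div_cancel₀ _ (sub_pos.2 hlt).ne']⟩

lemma monotone_rampPrimitive (hb : 0 < b) : Monotone (rampPrimitive b) :=
  monotone_of_hasDerivAt_nonneg (hasDerivAt_rampPrimitive hb) fun x => (clamp_mem_Icc (b * x)).1

lemma rampPrimitive_sub_le (hb : 0 < b) {x y : ℝ} (hxy : x ≤ y) :
    rampPrimitive b y - rampPrimitive b x ≤ y - x := by
  obtain ⟨z, -, hz⟩ := exists_rampPrimitive_sub_eq hb hxy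
  rw [hz]
  exact mul_le_of_le_one_right (sub_nonneg.2 hxy) (clamp_mem_Icc _).2

lemma hasDerivAt_rampPrimitive_sub (hb : 0 < b) (d s : ℝ) :
    HasDerivAt (fun x => rampPrimitive b (x - d)) (clamp (b * (s - d)) 0 1) s :=
  (hasDerivAt_rampPrimitive hb (s - d)).comp_sub_const s d

lemma monotone_rampPrimitive_sub_sub (hb : 0 < b) {d e : ℝ} (hde : d ≤ e) :
    Monotone fun s => rampPrimitive b (s - d) - rampPrimitive b (s - e) := by
  refine monotone_of_hasDerivAt_nonneg (fun s =>
    (hasDerivAt_rampPrimitive_sub hb d s).sub (hasDerivAt_rampPrimitive_sub hb e s)) fun s => ?_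
  exact sub_nonneg.2 (monotone_clamp (by gcongr))

/-- The distribution function of `U + W / b`, where `U` and `W` are independent and uniformly
distributed on `[0,1]`; equivalently `s ↦ ∫₀¹ clamp(b (s - t), 0, 1) dt`. Its quantile function
is `v ↦ s_v`. -/
def rampCDF (b s : ℝ) : ℝ := rampPrimitive b s - rampPrimitive b (s - 1)

lemma rampCDF_mem_Icc (hb : 0 < b) (s : ℝ) : rampCDF b s ∈ Icc (0 : ℝ) 1 :=
  ⟨sub_nonneg.2 (monotone_rampPrimitive hb (by linarith)),
    (rampPrimitive_sub_le hb (by linarith)).trans_eq (by ring)⟩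

lemma hasDerivAt_rampCDF (hb : 0 < b) (s : ℝ) :
    HasDerivAt (rampCDF b) (clamp (b * s) 0 1 - clamp (b * (s - 1)) 0 1) s :=
  (hasDerivAt_rampPrimitive hb s).sub (hasDerivAt_rampPrimitive_sub hb 1 s)

lemma continuous_rampCDF (hb : 0 < b) : Continuous (rampCDF b) :=
  continuous_iff_continuousAt.2 fun s => (hasDerivAt_rampCDF hb s).continuousAt

lemma monotone_rampCDF (hb : 0 < b) : Monotone (rampCDF b) := by
  simpa only [sub_zero] using! monotone_rampPrimitive_sub_sub hb zero_le_one

lemma strictMonoOn_rampCDF (hb : 0 < b) : StrictMonoOn (rampCDF b) (Icc 0 (1 + 1 / b)) := by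
  refine strictMonoOn_of_deriv_pos (convex_Icc _ _) (continuous_rampCDF hb).continuousOn
    fun s hs => ?_
  rw [interior_Icc] at hs
  have hlt : b * (s - 1) < 1 := by
    rw [mul_comm, ← lt_div_iff₀ hb]
    linarith [hs.2]
  rw [(hasDerivAt_rampCDF hb s).deriv, sub_pos]
  exact clamp_lt_clamp (by gcongr; linarith) hlt (mul_pos hb hs.1)

lemma rampCDF_of_le_min (hb : 0 < b) {s : ℝ} (h0 : 0 ≤ s) (h1 : s ≤ 1) (hr : s ≤ 1 / b) :
    rampCDF b s = b / 2 * s ^ 2 := by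
  rw [rampCDF, rampPrimitive_of_mem_Icc ⟨h0, hr⟩, rampPrimitive_of_nonpos hb (by linarith),
    sub_zero]

lemma rampCDF_of_mem_Icc_one_div_one (hb : 0 < b) {s : ℝ} (hs : s ∈ Icc (1 / b) 1) :
    rampCDF b s = s - 1 / (2 * b) := by
  rw [rampCDF, rampPrimitive_of_one_div_le hb hs.1,
    rampPrimitive_of_nonpos hb (sub_nonpos.2 hs.2), sub_zero]

lemma rampCDF_of_mem_Icc_one_one_div {s : ℝ} (hs : s ∈ Icc 1 (1 / b)) :
    rampCDF b s = b * (s - 1 / 2) := by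
  obtain ⟨h1, hr⟩ := hs
  rw [rampCDF, rampPrimitive_of_mem_Icc ⟨by linarith, hr⟩,
    rampPrimitive_of_mem_Icc ⟨by linarith, by linarith⟩]
  ring

lemma rampCDF_of_max_le (hb : 0 < b) {s : ℝ} (h1 : 1 ≤ s) (hr : 1 / b ≤ s) (hs : s ≤ 1 + 1 / b) :
    rampCDF b s = 1 - b / 2 * (1 + 1 / b - s) ^ 2 := by
  rw [rampCDF, rampPrimitive_of_one_div_le hb hr,
    rampPrimitive_of_mem_Icc ⟨by linarith, by linarith⟩]
  field_simp
  ring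

/-! ### The parameter `s_v` -/

lemma sqrt_two_mul_div_le (hb : 0 < b) {v : ℝ}
    (h : (1 ≤ b ∧ v ≤ 1 / (2 * b)) ∨ (b ≤ 1 ∧ v ≤ b / 2)) :
    √(2 * v / b) ≤ 1 ∧ √(2 * v / b) ≤ 1 / b := by
  rw [Real.sqrt_le_left zero_le_one, Real.sqrt_le_left (by positivity), div_pow,
    div_le_iff₀ hb, div_le_div_iff₀ hb (by positivity)]
  rcases h with ⟨hb1, hv⟩ | ⟨hb1, hv⟩
  · rw [le_div_iff₀ (by positivity)] at hv
    constructor <;> nlinarith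
  · constructor <;> nlinarith

lemma mul_sq_sqrt_two_mul_div (hb : 0 < b) {v : ℝ} (hv : 0 ≤ v) :
    b / 2 * √(2 * v / b) ^ 2 = v := by
  rw [Real.sq_sqrt (by positivity)]
  field_simp

lemma sPar_mem_Icc_and_rampCDF_sPar (hb : 0 < b) (v : I) :
    sPar b v ∈ Icc 0 (1 + 1 / b) ∧ rampCDF b (sPar b v) = v := by
  obtain ⟨v, hv0, hv1⟩ := v
  have hr : 0 < 1 / b := one_div_pos.2 hb
  have hr_half : 1 / (2 * b) = 1 / b / 2 := by field_simp
  rw [sPar]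
  split_ifs with hlow hmid_one_le hmid_le_one
  · obtain ⟨hs1, hsr⟩ := sqrt_two_mul_div_le hb hlow
    have hs0 := Real.sqrt_nonneg (2 * v / b)
    refine ⟨⟨hs0, by linarith⟩, ?_⟩
    rw [rampCDF_of_le_min hb hs0 hs1 hsr, mul_sq_sqrt_two_mul_div hb hv0]
  · refine ⟨⟨by linarith, by linarith⟩, ?_⟩
    rw [rampCDF_of_mem_Icc_one_div_one hb ⟨by linarith, by linarith⟩]
    ring
  · have hlower : 1 ≤ v / b + 1 / 2 := by
      have : 1 / 2 ≤ v / b := by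
        rw [le_div_iff₀ hb]
        linarith
      linarith
    have hupper : v / b + 1 / 2 ≤ 1 / b := by
      have : v / b ≤ (1 - b / 2) / b := by gcongr; exact hmid_le_one.2
      have : (1 - b / 2) / b = 1 / b - 1 / 2 := by field_simp
      linarith
    refine ⟨⟨by linarith, by linarith⟩, ?_⟩
    rw [rampCDF_of_mem_Icc_one_one_div ⟨hlower, hupper⟩]
    field_simp
    ring
  · have hhigh : (1 ≤ b ∧ 1 - v ≤ 1 / (2 * b)) ∨ (b ≤ 1 ∧ 1 - v ≤ b / 2) := by
      rcases le_total 1 b with hb1 | hb1 <;> grind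
    obtain ⟨hs1, hsr⟩ := sqrt_two_mul_div_le hb hhigh
    have hs0 := Real.sqrt_nonneg (2 * (1 - v) / b)
    refine ⟨⟨by linarith, by linarith⟩, ?_⟩
    rw [rampCDF_of_max_le hb (by linarith) (by linarith) (by linarith), sub_sub_cancel,
      mul_sq_sqrt_two_mul_div hb (sub_nonneg.2 hv1), sub_sub_cancel]

lemma sPar_mem_Icc (hb : 0 < b) (v : I) : sPar b v ∈ Icc 0 (1 + 1 / b) :=
  (sPar_mem_Icc_and_rampCDF_sPar hb v).1

lemma rampCDF_sPar (hb : 0 < b) (v : I) : rampCDF b (sPar b v) = v :=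
  (sPar_mem_Icc_and_rampCDF_sPar hb v).2

lemma rampCDF_le_iff (hb : 0 < b) {s : ℝ} (hs : s ∈ Icc 0 (1 + 1 / b)) (v : I) :
    rampCDF b s ≤ v ↔ s ≤ sPar b v := by
  rw [← (strictMonoOn_rampCDF hb).le_iff_le hs (sPar_mem_Icc hb v), rampCDF_sPar hb]

lemma monotone_sPar (hb : 0 < b) : Monotone fun v : I => sPar b v := fun v v' hvv' =>
  (rampCDF_le_iff hb (sPar_mem_Icc hb v) v').1 ((rampCDF_sPar hb v).trans_le hvv')

lemma integrable_sPar (hb : 0 < b) : Integrable fun v : I => sPar b v :=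
  Integrable.of_mem_Icc 0 (1 + 1 / b) (monotone_sPar hb).measurable.aemeasurable <|
    ae_of_all _ (sPar_mem_Icc hb)

/-! ### The copulas `C_b` -/

lemma copC_eq (hb : 0 < b) (u v : I) :
    copC b (u, v) = rampPrimitive b (sPar b v) - rampPrimitive b (sPar b v - u) := by
  obtain ⟨hs0, -⟩ := sPar_mem_Icc hb v
  have hv := rampCDF_sPar hb v
  have hu0 := u.2.1
  have hu1 := u.2.2
  rw [rampCDF] at hv
  unfold copC
  dsimp only
  split_ifs with ha hs
  · rcases le_max_iff.1 ha with hle | hle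
    · rw [rampPrimitive_of_one_div_le hb (by linarith),
        rampPrimitive_of_one_div_le hb (by linarith)]
      ring
    · rw [le_antisymm hle hu0, sub_zero, sub_self]
  · obtain ⟨hr, -⟩ := max_lt_iff.1 (not_le.1 ha)
    rw [aPar, rampPrimitive_of_mem_Icc (x := sPar b v - u) ⟨by linarith, by linarith⟩]
    rcases le_total (sPar b v) (1 / b) with hsr | hsr
    · rw [rampPrimitive_of_mem_Icc ⟨hs0, hsr⟩, max_eq_right (by linarith)]
      ring
    · rw [rampPrimitive_of_one_div_le hb hsr, max_eq_left (by linarith)]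
      field_simp
      ring
  · rw [rampPrimitive_of_nonpos hb (x := sPar b v - 1) (by linarith), sub_zero] at hv
    rw [rampPrimitive_of_nonpos hb (x := sPar b v - u) (by linarith), sub_zero, hv]

lemma copC_nonneg (hb : 0 < b) (u v : I) : 0 ≤ copC b (u, v) := by
  rw [copC_eq hb, sub_nonneg]
  exact monotone_rampPrimitive hb (by linarith [u.2.1])

lemma copC_le_left (hb : 0 < b) (u v : I) : copC b (u, v) ≤ u := by
  rw [copC_eq hb]
  exact (rampPrimitive_sub_le hb (by linarith [u.2.1])).trans_eq (sub_sub_cancel _ _)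

lemma copC_one_left (hb : 0 < b) (v : I) : copC b (1, v) = v :=
  (copC_eq hb 1 v).trans (rampCDF_sPar hb v)

lemma copC_zero_right (hb : 0 < b) (u : I) : copC b (u, 0) = 0 := by
  refine le_antisymm ?_ (copC_nonneg hb u 0)
  calc copC b (u, 0) ≤ copC b (1, 0) := by
        rw [copC_eq hb, copC_eq hb]
        exact sub_le_sub_left (monotone_rampPrimitive hb (sub_le_sub_left u.2.2 _)) _
    _ = 0 := copC_one_left hb 0

lemma copC_one_right (hb : 0 < b) (u : I) : copC b (u, 1) = u := by
  refine le_antisymm (copC_le_left hb u 1) ?_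
  have hsub : copC b (1, 1) - copC b (u, 1) ≤ 1 - u := by
    rw [copC_eq hb, copC_eq hb, sub_sub_sub_cancel_left]
    exact (rampPrimitive_sub_le hb (sub_le_sub_left u.2.2 _)).trans_eq
      (sub_sub_sub_cancel_left _ _ _)
  rw [copC_one_left hb, Icc.coe_one] at hsub
  linarith

lemma isCopula_copC (hb : 0 < b) : IsCopula (copC b) where
  mem_Icc p := ⟨copC_nonneg hb p.1 p.2, (copC_le_left hb p.1 p.2).trans p.1.2.2⟩
  grounded_left v := le_antisymm (copC_le_left hb 0 v) (copC_nonneg hb 0 v)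
  grounded_right := copC_zero_right hb
  marginal_left := copC_one_right hb
  marginal_right := copC_one_left hb
  two_increasing u u' v v' hu hv := by
    have := monotone_rampPrimitive_sub_sub hb (Subtype.coe_le_coe.2 hu) (monotone_sPar hb hv)
    simp only [copC_eq hb] at this ⊢
    linarith

lemma hasDerivWithinAt_firstSection_copC (hb : 0 < b) (t v : I) :
    HasDerivWithinAt (firstSection (copC b) v) (clamp (b * (sPar b v - t)) 0 1) (Icc 0 1) t := by
  refine hasDerivWithinAt_firstSection
    (f := fun u => rampPrimitive b (sPar b v) - rampPrimitive b (sPar b v - u))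
    (fun u => copC_eq hb u v) (HasDerivAt.hasDerivWithinAt ?_)
  simpa only [sub_neg_eq_add, zero_add, neg_neg, zero_sub] using!
    ((hasDerivAt_rampPrimitive hb (sPar b v - t)).comp_const_sub (sPar b v) t).const_sub
      (rampPrimitive b (sPar b v))

lemma partialOne_copC (hb : 0 < b) (t v : I) :
    partialOne (copC b) t v = clamp (b * (sPar b v - t)) 0 1 :=
  partialOne_eq_of_hasDerivWithinAt (hasDerivWithinAt_firstSection_copC hb t v)

lemma isUniqueMaximizer_copC (hb : 0 < b) : IsUniqueMaximizer (chatterjeeXi (copC b)) (copC b) :=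
  (isCopula_copC hb).isUniqueMaximizer_of_clamp hb.le ((integrable_sPar hb).const_mul b)
    fun t v => by rw [partialOne_copC hb, mul_sub]

/-- The conditional quantile function of `C_b`: `(U, rampCDF b (U + W / b))` has distribution
`C_b` if `U` and `W` are independent and uniformly distributed on `[0,1]`. -/
def rampQuantile (hb : 0 < b) (p : I × I) : I :=
  ⟨rampCDF b (p.1 + p.2 / b), rampCDF_mem_Icc hb _⟩

lemma add_div_mem_Icc (hb : 0 < b) (p : I × I) : (p.1 + p.2 / b : ℝ) ∈ Icc 0 (1 + 1 / b) :=
  ⟨add_nonneg p.1.2.1 (div_nonneg p.2.2.1 hb.le),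
    add_le_add p.1.2.2 (div_le_div_of_nonneg_right p.2.2.2 hb.le)⟩

lemma isCondQuantile_copC (hb : 0 < b) : IsCondQuantile (copC b) (rampQuantile hb) where
  measurable := ((continuous_rampCDF hb).comp (by fun_prop)).subtype_mk _ |>.measurable
  ae_le_iff v := by
    filter_upwards [ae_snd_ne 0] with p hw
    have hw_pos : 0 < (p.2 : ℝ) := unitInterval.coe_pos.2 (unitInterval.pos_iff_ne_zero.2 hw)
    rw [partialOne_copC hb, le_clamp_iff ⟨hw_pos, p.2.2.2⟩, ← div_le_iff₀' hb, le_sub_iff_add_le',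
      ← rampCDF_le_iff hb (add_div_mem_Icc hb p)]
    rfl

lemma isSI_copC (hb : 0 < b) : IsSI (copC b) :=
  (isCondQuantile_copC hb).isSI (isCopula_copC hb) fun _ _ _ htt' =>
    monotone_rampCDF hb (add_le_add_left (Subtype.coe_le_coe.2 htt') _)

lemma abs_copPi_sub_copC_le (hb : 0 < b) (p : I × I) : |copPi p - copC b p| ≤ b := by
  obtain ⟨u, v⟩ := p
  set s := sPar b v
  obtain ⟨y, hy, hv⟩ := exists_rampPrimitive_sub_eq hb (sub_le_self s zero_le_one)
  obtain ⟨z, hz, hC⟩ := exists_rampPrimitive_sub_eq hb (sub_le_self s u.2.1)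
  rw [← rampCDF, rampCDF_sPar hb, sub_sub_cancel, one_mul] at hv
  rw [← copC_eq hb, sub_sub_cancel] at hC
  have hyz : |y - z| ≤ 1 := abs_le.2
    ⟨by linarith [hy.1, hz.2], by linarith [hy.2, hz.1, u.2.2]⟩
  calc |copPi (u, v) - copC b (u, v)|
      = u * |clamp (b * y) 0 1 - clamp (b * z) 0 1| := by
        rw [copPi, hv, hC, ← mul_sub, abs_mul, abs_of_nonneg u.2.1]
    _ ≤ 1 * |b * y - b * z| :=
        mul_le_mul u.2.2 (abs_clamp_sub_clamp_le _ _) (abs_nonneg _) zero_le_one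
    _ ≤ b := by
        rw [one_mul, ← mul_sub, abs_mul, abs_of_pos hb]
        exact mul_le_of_le_one_right hb.le hyz

lemma copM_sub_copC_le (hb : 0 < b) (p : I × I) : copM p - copC b p ≤ 1 / (2 * b) := by
  obtain ⟨u, v⟩ := p
  obtain ⟨hs0, -⟩ := sPar_mem_Icc hb v
  obtain ⟨hlower, hupper⟩ := rampPrimitive_mem_Icc hb (sPar b v)
  have hshift := (rampPrimitive_mem_Icc hb (sPar b v - u)).2
  have hv := rampCDF_sPar hb v
  rw [max_eq_left hs0] at hlower hupper
  rw [copC_eq hb, copM]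
  rcases le_total (sPar b v) u with hsu | hus
  · rw [max_eq_right (sub_nonpos.2 hsu)] at hshift
    rw [rampCDF, rampPrimitive_of_nonpos hb (x := sPar b v - 1) (by linarith [u.2.2])] at hv
    linarith [min_le_right (u : ℝ) v]
  · rw [max_eq_left (sub_nonneg.2 hus)] at hshift
    linarith [min_le_left (u : ℝ) v]

lemma tendstoUniformly_copC_copPi : TendstoUniformly copC copPi (𝓝[>] 0) := by
  refine Metric.tendstoUniformly_iff.2 fun ε hε => ?_
  filter_upwards [Ioo_mem_nhdsGT hε] with b hb p
  exact (abs_copPi_sub_copC_le hb.1 p).trans_lt hb.2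

lemma tendstoUniformly_copC_copM : TendstoUniformly copC copM atTop := by
  refine Metric.tendstoUniformly_iff.2 fun ε hε => ?_
  filter_upwards [eventually_gt_atTop (1 / ε)] with b hb p
  have hb0 : 0 < b := (one_div_pos.2 hε).trans hb
  have hbε : 1 / (2 * b) < ε := by
    have := (one_div_lt hε hb0).1 hb
    have : 1 / (2 * b) = 1 / b / 2 := by field_simp
    linarith
  rw [Real.dist_eq, abs_of_nonneg (sub_nonneg.2 ((isCopula_copC hb0).le_copM p))]
  exact (copM_sub_copC_le hb0 p).trans_lt hbε

/-! ### The values `ρ(C_b)` and `ξ(C_b)` -/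

lemma integral_posPart_sq {r : ℝ} (hr : r ≠ 0) (c : ℝ) :
    ∫ w in (0 : ℝ)..1, max (c + r * w) 0 ^ 2 =
      (max (c + r) 0 ^ 3 - max c 0 ^ 3) / (3 * r) := by
  have hderiv (w : ℝ) : HasDerivAt (fun w => max (c + r * w) 0 ^ 3 / (3 * r))
      (max (c + r * w) 0 ^ 2) w := by
    have hinner : HasDerivAt (fun w => c + r * w) r w := by
      simpa using ((hasDerivAt_id w).const_mul r).const_add c
    refine (((hasDerivAt_posPart_pow 1 (c + r * w)).comp w hinner).div_const (3 * r)).congr_deriv ?_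
    push_cast
    field_simp
    ring
  rw [intervalIntegral.integral_eq_sub_of_hasDerivAt (fun w _ => hderiv w)
    (Continuous.intervalIntegrable (by fun_prop) _ _), mul_one, mul_zero, add_zero, sub_div]

lemma integral_mul_posPart_cube (c : ℝ) :
    ∫ t in (0 : ℝ)..1, t * max (t + c) 0 ^ 3 =
      max (1 + c) 0 ^ 4 / 4 - max (1 + c) 0 ^ 5 / 20 + max c 0 ^ 5 / 20 := by
  have hderiv (t : ℝ) : HasDerivAt
      (fun t => t * max (t + c) 0 ^ 4 / 4 - max (t + c) 0 ^ 5 / 20) (t * max (t + c) 0 ^ 3) t := by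
    refine ((((hasDerivAt_id t).mul (hasDerivAt_posPart_add_pow 2 c t)).div_const 4).sub
      ((hasDerivAt_posPart_add_pow 3 c t).div_const 20)).congr_deriv ?_
    simp only [id]
    push_cast
    ring
  rw [intervalIntegral.integral_eq_sub_of_hasDerivAt (fun t _ => hderiv t)
    (Continuous.intervalIntegrable (by fun_prop) _ _), zero_add]
  ring

lemma rampCDF_eq (b s : ℝ) :
    rampCDF b s = b / 2 * (max s 0 ^ 2 - max (s - 1) 0 ^ 2 - max (s - 1 / b) 0 ^ 2
      + max (s - 1 - 1 / b) 0 ^ 2) := by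
  rw [rampCDF, rampPrimitive, rampPrimitive]
  ring

lemma integral_rampCDF_add (hb : 0 < b) {t : ℝ} (ht : t ≤ 1) :
    ∫ w in (0 : ℝ)..1, rampCDF b (t + w / b) =
      b ^ 2 / 6 * (max (t + 1 / b) 0 ^ 3 - 2 * max t 0 ^ 3 + max (t - 1 / b) 0 ^ 3
        - max (t + (1 / b - 1)) 0 ^ 3) := by
  have hr : 0 < 1 / b := one_div_pos.2 hb
  have hexpand (w : ℝ) : rampCDF b (t + w / b) =
      b / 2 * (max (t + 1 / b * w) 0 ^ 2 - max (t - 1 + 1 / b * w) 0 ^ 2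
        - max (t - 1 / b + 1 / b * w) 0 ^ 2 + max (t - 1 - 1 / b + 1 / b * w) 0 ^ 2) := by
    rw [rampCDF_eq]
    ring_nf
  have hint (c : ℝ) : IntervalIntegrable (fun w : ℝ => max (c + 1 / b * w) 0 ^ 2) volume 0 1 :=
    Continuous.intervalIntegrable (by fun_prop) _ _
  have hshift : t - 1 + 1 / b = t + (1 / b - 1) := by ring
  simp only [hexpand]
  rw [intervalIntegral.integral_const_mul,
    intervalIntegral.integral_add (((hint _).sub (hint _)).sub (hint _)) (hint _),
    intervalIntegral.integral_sub ((hint _).sub (hint _)) (hint _),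
    intervalIntegral.integral_sub (hint _) (hint _)]
  simp only [integral_posPart_sq hr.ne', mul_one_div, div_div_eq_mul_div, sub_add_cancel]
  rw [max_eq_right (sub_nonpos.2 ht), max_eq_right (by linarith : t - 1 - 1 / b ≤ 0), hshift]
  ring

lemma integral_mul_rampQuantile (hb : 0 < b) :
    ∫ p : I × I, (p.1 : ℝ) * rampQuantile hb p =
      b ^ 2 / 6 * ((1 + 1 / b) ^ 4 / 4 - (1 + 1 / b) ^ 5 / 20 + (1 / b) ^ 5 / 20 - 2 / 5
        + (max (1 - 1 / b) 0 ^ 4 / 4 - max (1 - 1 / b) 0 ^ 5 / 20)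
        - ((1 / b) ^ 4 / 4 - (1 / b) ^ 5 / 20 + max (1 / b - 1) 0 ^ 5 / 20)) := by
  have hr : 0 < 1 / b := one_div_pos.2 hb
  have hint (c : ℝ) : IntervalIntegrable (fun t : ℝ => t * max (t + c) 0 ^ 3) volume 0 1 :=
    Continuous.intervalIntegrable (by fun_prop) _ _
  have hquantile : Integrable fun p : I × I => (p.1 : ℝ) * rampQuantile hb p :=
    (isCondQuantile_copC hb).integrable_mul_coe (integrable_of_continuous (by fun_prop))
  have hsection (t : I) : ∫ w : I, (t : ℝ) * rampQuantile hb (t, w) =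
      b ^ 2 / 6 * (t * max ((t : ℝ) + 1 / b) 0 ^ 3 - 2 * (t * max ((t : ℝ) + 0) 0 ^ 3)
        + t * max ((t : ℝ) + -(1 / b)) 0 ^ 3 - t * max ((t : ℝ) + (1 / b - 1)) 0 ^ 3) := by
    simp only [integral_const_mul, rampQuantile]
    rw [integral_coe_unitInterval fun w => rampCDF b (t + w / b), integral_rampCDF_add hb t.2.2]
    ring_nf
  rw [Measure.volume_eq_prod] at hquantile ⊢
  rw [integral_prod _ hquantile]
  simp only [hsection]
  rw [integral_coe_unitInterval fun t => b ^ 2 / 6 * (t * max (t + 1 / b) 0 ^ 3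
      - 2 * (t * max (t + 0) 0 ^ 3) + t * max (t + -(1 / b)) 0 ^ 3
      - t * max (t + (1 / b - 1)) 0 ^ 3),
    intervalIntegral.integral_const_mul,
    intervalIntegral.integral_sub (((hint _).sub ((hint _).const_mul 2)).add (hint _)) (hint _),
    intervalIntegral.integral_add ((hint _).sub ((hint _).const_mul 2)) (hint _),
    intervalIntegral.integral_sub (hint _) ((hint _).const_mul 2),
    intervalIntegral.integral_const_mul]
  simp only [integral_mul_posPart_cube]
  rw [max_eq_left (by linarith : 0 ≤ 1 + 1 / b), max_eq_left hr.le, max_self,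
    max_eq_right (neg_nonpos.2 hr.le), add_sub_cancel, max_eq_left hr.le, add_zero,
    max_eq_left zero_le_one, ← sub_eq_add_neg]
  ring

lemma spearmanRho_copC_of_le_one (hb : 0 < b) (hb1 : b ≤ 1) :
    spearmanRho (copC b) = b - 3 * b ^ 2 / 10 := by
  have hr : 1 ≤ 1 / b := (one_le_div hb).2 hb1
  rw [(isCondQuantile_copC hb).spearmanRho_eq (isCopula_copC hb), integral_mul_rampQuantile hb,
    max_eq_right (sub_nonpos.2 hr), max_eq_left (sub_nonneg.2 hr)]
  field_simp
  ring

lemma spearmanRho_copC_of_one_le (hb1 : 1 ≤ b) :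
    spearmanRho (copC b) = 1 - 1 / (2 * b ^ 2) + 1 / (5 * b ^ 3) := by
  have hb : 0 < b := zero_lt_one.trans_le hb1
  have hr : 1 / b ≤ 1 := (div_le_one hb).2 hb1
  rw [(isCondQuantile_copC hb).spearmanRho_eq (isCopula_copC hb), integral_mul_rampQuantile hb,
    max_eq_left (sub_nonneg.2 hr), max_eq_right (sub_nonpos.2 hr)]
  field_simp
  ring

lemma rampCDF_one_div_mul (hb : 0 < b) (s : ℝ) : rampCDF (1 / b) (b * s) = rampCDF b s := by
  have hposPart (x : ℝ) : max (b * x) 0 = b * max x 0 := by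
    rw [mul_max_of_nonneg _ _ hb.le, mul_zero]
  have hone : b * s - 1 = b * (s - 1 / b) := by field_simp
  have hadd : b * (s - 1 / b) - b = b * (s - 1 - 1 / b) := by ring
  rw [rampCDF_eq, rampCDF_eq, one_div_one_div, hone, hadd, ← mul_sub_one]
  simp only [hposPart]
  field_simp
  ring

lemma rampQuantile_swap (hb : 0 < b) (p : I × I) :
    rampQuantile (one_div_pos.2 hb) p.swap = rampQuantile hb p := by
  have harg : (p.2 + p.1 / (1 / b) : ℝ) = b * (p.1 + p.2 / b) := by
    field_simp
    ring
  simp only [rampQuantile, Prod.fst_swap, Prod.snd_swap, harg, rampCDF_one_div_mul hb]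

/-- Interchanging the two uniform variables in `U + W / b` amounts, up to scaling, to replacing
`b` by `1 / b`. -/
lemma chatterjeeXi_copC (hb : 0 < b) :
    chatterjeeXi (copC b) = 1 - spearmanRho (copC (1 / b)) := by
  have hswap : ∫ p : I × I, (p.2 : ℝ) * rampQuantile hb p =
      ∫ p : I × I, (p.1 : ℝ) * rampQuantile (one_div_pos.2 hb) p := by
    simp only [← rampQuantile_swap hb, Measure.volume_eq_prod]
    exact integral_prod_swap fun p : I × I => (p.1 : ℝ) * rampQuantile (one_div_pos.2 hb) p
  have hr := one_div_pos.2 hb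
  rw [(isCondQuantile_copC hb).chatterjeeXi_eq (isCopula_copC hb), hswap,
    (isCondQuantile_copC hr).spearmanRho_eq (isCopula_copC hr)]
  ring

lemma chatterjeeXi_copC_of_le_one (hb : 0 < b) (hb1 : b ≤ 1) :
    chatterjeeXi (copC b) = b ^ 2 / 2 - b ^ 3 / 5 := by
  rw [chatterjeeXi_copC hb, spearmanRho_copC_of_one_le ((one_le_div hb).2 hb1)]
  field_simp
  ring

lemma chatterjeeXi_copC_of_one_le (hb1 : 1 ≤ b) :
    chatterjeeXi (copC b) = 1 - 1 / b + 3 / (10 * b ^ 2) := by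
  have hb : 0 < b := zero_lt_one.trans_le hb1
  rw [chatterjeeXi_copC hb,
    spearmanRho_copC_of_le_one (one_div_pos.2 hb) ((div_le_one hb).2 hb1)]
  field_simp
  ring

/-! ### The parameter `b_c` -/

lemma cos_third_arccos {y : ℝ} (hy : y ∈ Icc (-1 : ℝ) 1) :
    1 / 2 ≤ Real.cos (1 / 3 * Real.arccos y) ∧
      4 * Real.cos (1 / 3 * Real.arccos y) ^ 3 - 3 * Real.cos (1 / 3 * Real.arccos y) = y := by
  have hle := Real.arccos_le_pi y
  constructor
  · rw [← Real.cos_pi_div_three]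
    exact Real.cos_le_cos_of_nonneg_of_le_pi
      (mul_nonneg (by norm_num) (Real.arccos_nonneg y)) (by linarith [Real.pi_pos]) (by linarith)
  · have hthree : 3 * (1 / 3 * Real.arccos y) = Real.arccos y := by ring
    rw [← Real.cos_three_mul, hthree, Real.cos_arccos hy.1 hy.2]

lemma bPar_of_le {x : ℝ} (hx0 : 0 < x) (hx : x ≤ 3 / 10) :
    bPar x ∈ Ioc 0 (3 / 2) ∧ bPar x ^ 2 / 2 - bPar x ^ 3 / 5 = x := by
  have hr0 : 0 < √(6 * x) := Real.sqrt_pos.2 (by linarith)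
  have hr_sq : √(6 * x) ^ 2 = 6 * x := Real.sq_sqrt (by linarith)
  rw [bPar, if_pos hx]
  set r := √(6 * x)
  have hr : r ≤ 3 / 2 := by nlinarith
  obtain ⟨hk, hcubic⟩ := cos_third_arccos (y := -(3 * r / 5)) ⟨by linarith, by linarith⟩
  set k := Real.cos (1 / 3 * Real.arccos (-(3 * r / 5)))
  have : 0 < k := by linarith
  refine ⟨⟨by positivity, ?_⟩, ?_⟩
  · rw [div_le_iff₀ (by positivity)]
    linarith
  · calc (r / (2 * k)) ^ 2 / 2 - (r / (2 * k)) ^ 3 / 5 = r ^ 2 * (5 * k - r) / (40 * k ^ 3) := by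
          field_simp
          ring
      _ = r ^ 2 / 6 := by
          have : 5 * k - r = 20 / 3 * k ^ 3 := by linarith
          rw [this]
          field_simp
          norm_num
      _ = x := by rw [hr_sq, mul_div_cancel_left₀ _ (by norm_num)]

lemma bPar_le_one {x : ℝ} (hx0 : 0 < x) (hx : x ≤ 3 / 10) : bPar x ≤ 1 := by
  obtain ⟨⟨-, hle⟩, heq⟩ := bPar_of_le hx0 hx
  by_contra! hlt
  have : 3 / 10 - x = -((bPar x - 1) * (3 + 3 * bPar x - 2 * bPar x ^ 2)) / 10 := by
    linear_combination heq
  have hquad : 0 < 3 + 3 * bPar x - 2 * bPar x ^ 2 := by nlinarith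
  have := mul_pos (sub_pos.2 hlt) hquad
  linarith

lemma one_le_bPar {x : ℝ} (hx : 3 / 10 < x) (hx1 : x < 1) : 1 ≤ bPar x := by
  have hq : 2 ≤ √(5 * (6 * x - 1)) := Real.le_sqrt_of_sq_le (by linarith)
  rw [bPar, if_neg hx.not_ge, le_div_iff₀ (by linarith)]
  linarith

lemma bPar_of_lt {x : ℝ} (hx : 3 / 10 < x) (hx1 : x < 1) :
    1 - 1 / bPar x + 3 / (10 * bPar x ^ 2) = x := by
  have hb : 0 < bPar x := zero_lt_one.trans_le (one_le_bPar hx hx1)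
  have hq_sq : √(5 * (6 * x - 1)) ^ 2 = 5 * (6 * x - 1) := Real.sq_sqrt (by linarith)
  have hy : 1 - x ≠ 0 := by linarith
  have hquad : 10 * (1 - x) * bPar x ^ 2 - 10 * bPar x + 3 = 0 := by
    rw [bPar, if_neg hx.not_ge]
    set q := √(5 * (6 * x - 1))
    field_simp
    linear_combination hq_sq
  field_simp
  linarith

lemma bPar_pos {c : ℝ} (hc0 : 0 < c) (hc1 : c < 1) : 0 < bPar c := by
  rcases le_or_gt c (3 / 10) with h | h
  · exact (bPar_of_le hc0 h).1.1
  · exact zero_lt_one.trans_le (one_le_bPar h hc1)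

lemma chatterjeeXi_copC_bPar {c : ℝ} (hc0 : 0 < c) (hc1 : c < 1) :
    chatterjeeXi (copC (bPar c)) = c := by
  rcases le_or_gt c (3 / 10) with h | h
  · rw [chatterjeeXi_copC_of_le_one (bPar_pos hc0 hc1) (bPar_le_one hc0 h), (bPar_of_le hc0 h).2]
  · rw [chatterjeeXi_copC_of_one_le (one_le_bPar h hc1), bPar_of_lt h hc1]

lemma spearmanRho_copC_bPar {c : ℝ} (hc0 : 0 < c) (hc1 : c < 1) :
    spearmanRho (copC (bPar c)) = maxRho c := by
  rw [maxRho, if_neg hc0.ne']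
  rcases le_or_gt c (3 / 10) with h | h
  · rw [if_pos h, spearmanRho_copC_of_le_one (bPar_pos hc0 hc1) (bPar_le_one hc0 h)]
  · rw [if_neg h.not_ge, if_pos hc1, spearmanRho_copC_of_one_le (one_le_bPar h hc1)]

lemma maxRho_zero : maxRho 0 = 0 := if_pos rfl

lemma maxRho_one : maxRho 1 = 1 := by
  rw [maxRho, if_neg one_ne_zero, if_neg (by norm_num), if_neg (lt_irrefl 1)]

end XiRho

end

theorem mainTheorem2 :
    -- for `b > 0`, `C_b` is an SI copula with clamped linear first partial derivative
    (∀ b : ℝ, 0 < b →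
      XiRho.IsCopula (XiRho.copC b) ∧ XiRho.IsSI (XiRho.copC b) ∧
      ∀ t v : unitInterval,
        HasDerivWithinAt (XiRho.firstSection (XiRho.copC b) v)
          (XiRho.clamp (b * (XiRho.sPar b v - t)) 0 1) (Set.Icc 0 1) t) ∧
    -- the case `c ∈ (0,1)`
    (∀ c : ℝ, 0 < c → c < 1 →
      0 < XiRho.bPar c ∧
      XiRho.IsUniqueMaximizer c (XiRho.copC (XiRho.bPar c)) ∧
      XiRho.chatterjeeXi (XiRho.copC (XiRho.bPar c)) = c ∧
      XiRho.spearmanRho (XiRho.copC (XiRho.bPar c)) = XiRho.maxRho c) ∧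
    -- the case `c = 0`
    (XiRho.IsUniqueMaximizer 0 XiRho.copPi ∧ XiRho.spearmanRho XiRho.copPi = XiRho.maxRho 0 ∧
      TendstoUniformly XiRho.copC XiRho.copPi (nhdsWithin 0 (Set.Ioi 0))) ∧
    -- the case `c = 1`
    (XiRho.IsUniqueMaximizer 1 XiRho.copM ∧ XiRho.spearmanRho XiRho.copM = XiRho.maxRho 1 ∧
      TendstoUniformly XiRho.copC XiRho.copM Filter.atTop) := by
  refine ⟨fun b hb => ⟨XiRho.isCopula_copC hb, XiRho.isSI_copC hb,
      XiRho.hasDerivWithinAt_firstSection_copC hb⟩,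
    fun c hc0 hc1 => ⟨XiRho.bPar_pos hc0 hc1, ?_, XiRho.chatterjeeXi_copC_bPar hc0 hc1,
      XiRho.spearmanRho_copC_bPar hc0 hc1⟩,
    ⟨XiRho.isUniqueMaximizer_copPi, XiRho.spearmanRho_copPi.trans XiRho.maxRho_zero.symm,
      XiRho.tendstoUniformly_copC_copPi⟩,
    ⟨XiRho.isUniqueMaximizer_copM, XiRho.spearmanRho_copM.trans XiRho.maxRho_one.symm,
      XiRho.tendstoUniformly_copC_copM⟩⟩
  have hmax := XiRho.isUniqueMaximizer_copC (XiRho.bPar_pos hc0 hc1)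
  rwa [XiRho.chatterjeeXi_copC_bPar hc0 hc1] at hmax
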